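/- Theorem 1.3. An outer commutator word is a group word obtained by nesting commutators, always using different variables: a single variable $x$ is an outer commutator word, and if $u$ and $v$ are outer commutator words with no variable in common, then $[u,v]$ is an outer commutator word. For a profinite group $G$, "subgroup" means closed subgroup, "generated" means topologically generated, and $w(G)$ denotes the closed subgroup of $G$ generated by all $w$-values in $G$, that is, by all elements obtained by substituting elements of $G$ for the variables of $w$. A profinite group is said to be of finite rank if there is a non-negative integer $r$ such that each of its finitely generated subgroups can be generated by at most $r$ elements. Let $w$ be an outer commutator word and let $G$ be a profinite group that has finitely many subgroups $G_1,G_2,\dots,G_s$ whose union contains all $w$-values in $G$. If each of the subgroups $G_1,G_2,\dots,G_s$ is of finite rank, then $w(G)$ has finite rank as well. -/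

import Mathlib

open scoped commutatorElement

/-- `IsOuterCommutatorOn w S`: the group word `w` is an outer (multilinear) commutator word whose
set of variables is `S`. A single variable is such a word, and so is `⁅u, v⁆` whenever `u` and `v`
are such words having no variable in common. -/
inductive IsOuterCommutatorOn {α : Type*} : FreeGroup α → Set α → Prop
  | var (x : α) : IsOuterCommutatorOn (FreeGroup.of x) {x}
  | comm {u v : FreeGroup α} {S T : Set α} (hu : IsOuterCommutatorOn u S)
      (hv : IsOuterCommutatorOn v T) (hST : Disjoint S T) : IsOuterCommutatorOn ⁅u, v⁆ (S ∪ T)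

/-- A group word is an outer commutator word if it is obtained by nesting commutators, always
using different variables. -/
def IsOuterCommutatorWord {α : Type*} (w : FreeGroup α) : Prop :=
  ∃ S : Set α, IsOuterCommutatorOn w S

/-- The set of `w`-values in the group `G`: all elements obtained by substituting elements of `G`
for the variables of the word `w`. -/
def wordValues {α : Type*} (w : FreeGroup α) (G : Type*) [Group G] : Set G :=
  Set.range fun g : α → G => FreeGroup.lift g w

/-- The closed subgroup of `G` topologically generated by `X`. -/
def topologicalSpan {G : Type*} [Group G] [TopologicalSpace G] [IsTopologicalGroup G]
    (X : Set G) : Subgroup G :=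
  (Subgroup.closure X).topologicalClosure

/-- The verbal subgroup `w(G)` of a topological group: the closed subgroup topologically generated
by all `w`-values. -/
def verbalSubgroup {α : Type*} (w : FreeGroup α) (G : Type*) [Group G] [TopologicalSpace G]
    [IsTopologicalGroup G] : Subgroup G :=
  topologicalSpan (wordValues w G)

/-- A topological group has finite rank if for some `r`, every closed subgroup which is
topologically generated by finitely many elements is topologically generated by at most `r`
elements. -/
def HasFiniteRank (G : Type*) [Group G] [TopologicalSpace G] [IsTopologicalGroup G] : Prop :=
  ∃ r : ℕ, ∀ K : Subgroup G, (∃ T : Finset G, topologicalSpan (T : Set G) = K) →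
    ∃ S : Finset G, S.card ≤ r ∧ topologicalSpan (S : Set G) = K

open Subgroup

/-! The working notion is `HasUniformRank`: one bound serves for all closed subgroups, finitely
generated or not. For closed subgroups of a profinite group, compactness makes it equivalent to
finite rank. It survives products `A ⊔ B` of closed subgroups with `A` normalising `B`, and passes
from a closed subgroup to any subgroup covered by finitely many of its cosets.

By Baire category some `H i` contains all values of `w` on cosets of an open normal subgroup `N`.
Outer commutator words are multilinear up to conjugation (`exists_lift_update_mul`), which moves the
cosets to `N` itself, so `w(N)` lies in `H i` and has finite rank.

To climb from `N` to `G`, let each variable range over a term of `⊤, N, N', N'', …`. If one term is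
deep enough, the verbal subgroup lies in `w(N)`. Otherwise let `X` be its closure and `P` the
product of the closed subgroups obtained by deepening one variable by one step. Commutation acts
like a derivation (`commutator_verbalIn_le`), so `⁅X, X ⊓ N⁆ ≤ P`. Thus `X/P` is central-by-finite,
and by Schur `⁅X, X⁆P/P` is finite. What remains is abelian and topologically generated by the
images of the finitely many `X ⊓ H i`, so `X` has finite rank if `P` does. Downward induction ends
with every variable ranging over `G`. -/

theorem mem_sup_of_le_normalizer {G : Type*} [Group G] {A B : Subgroup G} (h : A ≤ normalizer B) {x : G}
    (hx : x ∈ A ⊔ B) : ∃ a ∈ A, ∃ b ∈ B, a * b = x := by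
  have : x ∈ ((A ⊔ B : Subgroup G) : Set G) := hx
  rw [coe_mul_of_left_le_normalizer_right A B h] at this
  exact Set.mem_mul.1 this

/-! ### Rank of closed subgroups: extensions, finite covers by cosets, abelian quotients. -/

section Rank

variable {G : Type*} [Group G] [TopologicalSpace G] [IsTopologicalGroup G]

theorem subset_topologicalSpan (X : Set G) : X ⊆ topologicalSpan X :=
  subset_closure.trans (Subgroup.le_topologicalClosure _)

theorem isClosed_topologicalSpan (X : Set G) : IsClosed (topologicalSpan X : Set G) :=
  Subgroup.isClosed_topologicalClosure _

theorem topologicalSpan_le {X : Set G} {K : Subgroup G} (hK : IsClosed (K : Set G))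
    (h : X ⊆ K) : topologicalSpan X ≤ K :=
  Subgroup.topologicalClosure_minimal _ ((closure_le K).2 h) hK

theorem topologicalSpan_eq {X : Set G} {K : Subgroup G} (hK : IsClosed (K : Set G))
    (h : X ⊆ K) (h' : K ≤ topologicalSpan X) : topologicalSpan X = K :=
  le_antisymm (topologicalSpan_le hK h) h'

/-- Every closed subgroup of `G` contained in `K` is topologically generated by at most `r`
elements, for some `r` not depending on that subgroup. -/
def HasUniformRank (K : Subgroup G) : Prop :=
  ∃ r : ℕ, ∀ L ≤ K, IsClosed (L : Set G) →
    ∃ S : Finset G, S.card ≤ r ∧ topologicalSpan (S : Set G) = L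

theorem HasUniformRank.mono {K K' : Subgroup G} (h : HasUniformRank K) (hle : K' ≤ K) :
    HasUniformRank K' := by
  obtain ⟨r, hr⟩ := h
  exact ⟨r, fun L hL => hr L (hL.trans hle)⟩

theorem isClosed_sup_of_le_normalizer [CompactSpace G] [T2Space G] {A B : Subgroup G}
    (hA : IsClosed (A : Set G)) (hB : IsClosed (B : Set G)) (h : A ≤ normalizer B) :
    IsClosed ((A ⊔ B : Subgroup G) : Set G) := by
  rw [coe_mul_of_left_le_normalizer_right A B h]
  exact (hA.isCompact.mul hB.isCompact).isClosed

/-- Ranks add in an extension. `A ⊓ (L ⊔ B)` plays the role of the image of `L` modulo `B`: its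
generators are corrected by elements of `B` to lie in `L`, and generators of `L ⊓ B` supply the
rest. -/
theorem HasUniformRank.sup [CompactSpace G] [T2Space G] {A B : Subgroup G}
    (hA : IsClosed (A : Set G)) (hB : IsClosed (B : Set G)) (h : A ≤ normalizer B)
    (hrA : HasUniformRank A) (hrB : HasUniformRank B) : HasUniformRank (A ⊔ B) := by
  classical
  obtain ⟨r, hr⟩ := hrA
  obtain ⟨t, ht⟩ := hrB
  refine ⟨r + t, fun L hL hLc => ?_⟩
  have hAB : A ⊔ B ≤ normalizer B := sup_le h le_normalizer
  have hLB : L ≤ normalizer B := hL.trans hAB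
  obtain ⟨T, hTcard, hT⟩ := ht (L ⊓ B) inf_le_right (hLc.inter hB)
  obtain ⟨S, hScard, hS⟩ := hr (A ⊓ (L ⊔ B)) inf_le_left
    (hA.inter (isClosed_sup_of_le_normalizer hLc hB hLB))
  have hSmem : ∀ a ∈ S, ∃ l ∈ L, ∃ b ∈ B, l * b = a := fun a ha =>
    mem_sup_of_le_normalizer hLB (hS.le (subset_topologicalSpan _ ha)).2
  choose! φ hφ ψ hψ hφψ using hSmem
  have hsub : ((S.image φ ∪ T : Finset G) : Set G) ⊆ L := by
    intro x hx
    simp only [Finset.coe_union, Finset.coe_image, Set.mem_union, Set.mem_image,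
      Finset.mem_coe] at hx
    rcases hx with ⟨a, ha, rfl⟩ | hx
    · exact hφ a ha
    · exact (hT.le (subset_topologicalSpan _ hx)).1
  refine ⟨S.image φ ∪ T, ?_, topologicalSpan_eq hLc hsub ?_⟩
  · exact (Finset.card_union_le _ _).trans (add_le_add (Finset.card_image_le.trans hScard) hTcard)
  set M := topologicalSpan ((S.image φ ∪ T : Finset G) : Set G) with hM
  have hML : M ≤ L := topologicalSpan_le hLc hsub
  have hMc : IsClosed (M : Set G) := isClosed_topologicalSpan _
  have hMB : M ≤ normalizer B := hML.trans hLB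
  have hLBM : L ⊓ B ≤ M := by
    rw [← hT]
    exact topologicalSpan_le hMc (Set.Subset.trans (by simp) (subset_topologicalSpan _))
  have hAM : A ⊓ (L ⊔ B) ≤ M ⊔ B := by
    rw [← hS]
    refine topologicalSpan_le (isClosed_sup_of_le_normalizer hMc hB hMB) fun a ha => ?_
    rw [← hφψ a ha]
    refine mul_mem_sup (subset_topologicalSpan _ ?_) (hψ a ha)
    simp only [Finset.coe_union, Finset.coe_image]
    exact Or.inl ⟨a, ha, rfl⟩
  intro l hl
  obtain ⟨a, ha, b, hb, rfl⟩ := mem_sup_of_le_normalizer h (hL hl)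
  have ha' : a ∈ L ⊔ B := by
    have := mul_mem_sup hl (inv_mem hb)
    rwa [mul_inv_cancel_right] at this
  obtain ⟨m, hm, c, hc, rfl⟩ := mem_sup_of_le_normalizer hMB (hAM ⟨ha, ha'⟩)
  have hcb : c * b ∈ L ⊓ B := by
    refine ⟨?_, mul_mem hc hb⟩
    have := mul_mem (inv_mem (hML hm)) hl
    rwa [mul_assoc, inv_mul_cancel_left] at this
  rw [mul_assoc]
  exact mul_mem hm (hLBM hcb)

/-- A subgroup covered by finitely many left cosets of a subgroup of finite rank has finite rank. -/
theorem HasUniformRank.of_finite_cosets {P Q : Subgroup G} (hP : IsClosed (P : Set G))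
    (hrP : HasUniformRank P) (F : Finset G) (hF : ∀ q ∈ Q, ∃ f ∈ F, f⁻¹ * q ∈ P) :
    HasUniformRank Q := by
  classical
  obtain ⟨r, hr⟩ := hrP
  refine ⟨F.card + r, fun L hL hLc => ?_⟩
  obtain ⟨T, hTcard, hT⟩ := hr (L ⊓ P) inf_le_right (hLc.inter hP)
  -- Each representative is replaced by an element of `L` in the same coset of `P`; the value 1 is a
  -- default for cosets missing `L`.
  have key : ∀ f : G, ∃ l ∈ L, (∃ x ∈ L, f⁻¹ * x ∈ P) → f⁻¹ * l ∈ P := by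
    intro f
    by_cases h : ∃ x ∈ L, f⁻¹ * x ∈ P
    · obtain ⟨x, hx, hx'⟩ := h
      exact ⟨x, hx, fun _ => hx'⟩
    · exact ⟨1, one_mem _, fun h' => absurd h' h⟩
  choose φ hφ hφ' using key
  have hsub : ((F.image φ ∪ T : Finset G) : Set G) ⊆ L := by
    intro x hx
    simp only [Finset.coe_union, Finset.coe_image, Set.mem_union, Set.mem_image,
      Finset.mem_coe] at hx
    rcases hx with ⟨a, ha, rfl⟩ | hx
    · exact hφ a
    · exact (hT.le (subset_topologicalSpan _ hx)).1
  refine ⟨F.image φ ∪ T, ?_, topologicalSpan_eq hLc hsub ?_⟩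
  · exact (Finset.card_union_le _ _).trans (add_le_add Finset.card_image_le hTcard)
  have hLP : L ⊓ P ≤ topologicalSpan ((F.image φ ∪ T : Finset G) : Set G) := by
    rw [← hT]
    exact topologicalSpan_le (isClosed_topologicalSpan _)
      (Set.Subset.trans (by simp) (subset_topologicalSpan _))
  intro l hl
  obtain ⟨f, hf, hfl⟩ := hF l (hL hl)
  have h1 : (φ f)⁻¹ * l ∈ L ⊓ P := by
    refine ⟨L.mul_mem (L.inv_mem (hφ f)) hl, ?_⟩
    have := P.mul_mem (P.inv_mem (hφ' f ⟨l, hl, hfl⟩)) hfl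
    simpa [mul_assoc] using this
  have h2 : φ f ∈ topologicalSpan ((F.image φ ∪ T : Finset G) : Set G) := by
    apply subset_topologicalSpan
    simp only [Finset.coe_union, Finset.coe_image]
    exact Or.inl ⟨f, hf, rfl⟩
  simpa using mul_mem h2 (hLP h1)

theorem isClosed_of_finite_cosets {P Q : Subgroup G} (hP : IsClosed (P : Set G)) (hPQ : P ≤ Q)
    (F : Finset G) (hF : ∀ q ∈ Q, ∃ f ∈ F, f⁻¹ * q ∈ P) : IsClosed (Q : Set G) := by
  have : (Q : Set G) = ⋃ f ∈ {f ∈ (F : Set G) | f ∈ Q}, (fun x => f⁻¹ * x) ⁻¹' (P : Set G) := by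
    ext q
    simp only [SetLike.mem_coe, Set.mem_ofPred_eq, Set.mem_iUnion, Set.mem_preimage, exists_prop]
    constructor
    · intro hq
      obtain ⟨f, hf, hfq⟩ := hF q hq
      refine ⟨f, ⟨hf, ?_⟩, hfq⟩
      simpa using mul_mem hq (inv_mem (hPQ hfq))
    · rintro ⟨f, ⟨-, hf⟩, hfq⟩
      simpa using mul_mem hf (hPQ hfq)
  rw [this]
  exact (F.finite_toSet.subset (Set.sep_subset _ _)).isClosed_biUnion
    fun f _ => hP.preimage (by fun_prop)

theorem HasUniformRank.iSup_of_normal [CompactSpace G] [T2Space G] {ι : Type*} (s : Finset ι)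
    (A : ι → Subgroup G) (hn : ∀ i ∈ s, (A i).Normal) (hA : ∀ i ∈ s, IsClosed (A i : Set G))
    (hr : ∀ i ∈ s, HasUniformRank (A i)) :
    (⨆ i ∈ s, A i).Normal ∧ IsClosed ((⨆ i ∈ s, A i : Subgroup G) : Set G) ∧
      HasUniformRank (⨆ i ∈ s, A i) := by
  classical
  induction s using Finset.induction_on with
  | empty =>
    simp only [Finset.notMem_empty, iSup_false, iSup_bot]
    refine ⟨inferInstance, by simp, 0, fun L hL _ => ⟨∅, by simp, ?_⟩⟩
    rw [le_bot_iff.1 hL]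
    exact topologicalSpan_eq (by simp) (by simp) bot_le
  | insert a s ha ih =>
    obtain ⟨h1, h2, h3⟩ := ih (fun i hi => hn i (Finset.mem_insert_of_mem hi))
      (fun i hi => hA i (Finset.mem_insert_of_mem hi))
      (fun i hi => hr i (Finset.mem_insert_of_mem hi))
    have := hn a (Finset.mem_insert_self _ _)
    have hle : A a ≤ normalizer (⨆ i ∈ s, A i : Subgroup G) := le_normalizer_of_normal
    have hAa := hA a (Finset.mem_insert_self _ _)
    rw [Finset.iSup_insert]
    exact ⟨inferInstance, isClosed_sup_of_le_normalizer hAa h2 hle,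
      HasUniformRank.sup hAa h2 hle (hr a (Finset.mem_insert_self _ _)) h3⟩

/-- If `X` is abelian modulo `P` and is topologically generated by finitely many subgroups of
finite rank together with `P`, then `X` has finite rank. -/
theorem HasUniformRank.of_commutator_le [CompactSpace G] [T2Space G] {ι : Type*} [Finite ι]
    {P X : Subgroup G} (hP : IsClosed (P : Set G)) (hPX : P ≤ X) (hXP : ⁅X, X⁆ ≤ P)
    (hrP : HasUniformRank P) (H : ι → Subgroup G) (hH : ∀ i, IsClosed (H i : Set G))
    (hrH : ∀ i, HasUniformRank (H i)) (hX : IsClosed (X : Set G)) {Y : Set G}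
    (hY : Y ⊆ ⋃ i, (H i : Set G)) (hYX : topologicalSpan Y = X) : HasUniformRank X := by
  classical
  cases nonempty_fintype ι
  -- The `X ⊓ H i` are absorbed one at a time. Any `R` between `P` and `X` contains `⁅X, X⁆`, hence
  -- is normalised by `X`, so each step is a product to which `HasUniformRank.sup` applies.
  have key : ∀ s : Finset ι, ∃ R : Subgroup G, P ≤ R ∧ R ≤ X ∧ IsClosed (R : Set G) ∧
      HasUniformRank R ∧ ∀ i ∈ s, X ⊓ H i ≤ R := by
    intro s
    induction s using Finset.induction_on with
    | empty => exact ⟨P, le_rfl, hPX, hP, hrP, by simp⟩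
    | insert a s _ ih =>
      obtain ⟨R, h1, h2, h3, h4, h5⟩ := ih
      have hn : X ⊓ H a ≤ normalizer R := by
        rw [le_normalizer_iff_commutator_le_right]
        exact (commutator_mono inf_le_left h2).trans (hXP.trans h1)
      have hc : IsClosed ((X ⊓ H a : Subgroup G) : Set G) := hX.inter (hH a)
      refine ⟨(X ⊓ H a) ⊔ R, h1.trans le_sup_right, sup_le inf_le_left h2,
        isClosed_sup_of_le_normalizer hc h3 hn,
        HasUniformRank.sup hc h3 hn ((hrH a).mono inf_le_right) h4, ?_⟩
      intro i hi
      rcases Finset.mem_insert.1 hi with rfl | hi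
      · exact le_sup_left
      · exact (h5 i hi).trans le_sup_right
  obtain ⟨R, -, -, h3, h4, h5⟩ := key Finset.univ
  refine h4.mono ?_
  rw [← hYX]
  refine topologicalSpan_le h3 fun y hy => ?_
  obtain ⟨i, hi⟩ := Set.mem_iUnion.1 (hY hy)
  exact h5 i (Finset.mem_univ i) ⟨hYX.le (subset_topologicalSpan _ hy), hi⟩

end Rank

/-! ### Schur's theorem on central-by-finite groups. -/

section Schur

/-- A commutator depends only on the cosets of its entries modulo the center, so there are finitely
many commutators; a group with finitely many commutators has finite derived subgroup. -/
theorem finite_commutator_of_finiteIndex_center {Y : Type*} [Group Y]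
    [(center Y).FiniteIndex] : Finite (_root_.commutator Y) := by
  have : Finite (commutatorSet Y) := by
    refine (Set.finite_range fun p : (Y ⧸ center Y) × (Y ⧸ center Y) =>
      ⁅p.1.out, p.2.out⁆).subset ?_
    rintro _ ⟨a, b, rfl⟩
    refine ⟨(QuotientGroup.mk a, QuotientGroup.mk b), ?_⟩
    obtain ⟨⟨z, hz⟩, hz'⟩ := QuotientGroup.mk_out_eq_mul (center Y) a
    obtain ⟨⟨t, ht⟩, ht'⟩ := QuotientGroup.mk_out_eq_mul (center Y) b
    simp only [hz', ht']
    have hzc : ∀ g : Y, ⁅z, g⁆ = 1 := fun g =>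
      commutatorElement_eq_one_iff_mul_comm.2 (mem_center_iff.1 hz g).symm
    have htc : ∀ g : Y, ⁅g, t⁆ = 1 := fun g =>
      commutatorElement_eq_one_iff_mul_comm.2 (mem_center_iff.1 ht g)
    simp [commutatorElement_mul_left_eq_conj_mul, commutatorElement_mul_right_eq_mul_conj, hzc, htc]
  infer_instance

/-- Schur's theorem, relative to a normal subgroup. -/
theorem exists_finset_cosets_commutator {G : Type*} [Group G] {P X N : Subgroup G} [P.Normal]
    [N.FiniteIndex] (h : ⁅X, X ⊓ N⁆ ≤ P) :
    ∃ F : Finset G, ∀ q ∈ ⁅X, X⁆ ⊔ P, ∃ f ∈ F, f⁻¹ * q ∈ P := by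
  classical
  let π := QuotientGroup.mk' (P.subgroupOf X)
  have hle : (N.subgroupOf X).map π ≤ center (X ⧸ P.subgroupOf X) := by
    rintro _ ⟨n, hn, rfl⟩
    rw [mem_center_iff]
    intro g
    obtain ⟨x, rfl⟩ := QuotientGroup.mk'_surjective _ g
    rw [← commutatorElement_eq_one_iff_mul_comm, ← map_commutatorElement,
      QuotientGroup.mk'_apply, QuotientGroup.eq_one_iff, mem_subgroupOf]
    exact h (commutator_mem_commutator x.2 ⟨n.2, hn⟩)
  have : ((N.subgroupOf X).map π).FiniteIndex :=
    ⟨fun h0 => (inferInstance : (N.subgroupOf X).FiniteIndex).index_ne_zero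
      (Nat.eq_zero_of_zero_dvd
        (h0 ▸ index_map_dvd _ (QuotientGroup.mk'_surjective _)))⟩
  have : (center (X ⧸ P.subgroupOf X)).FiniteIndex := finiteIndex_of_le hle
  have := finite_commutator_of_finiteIndex_center (Y := X ⧸ P.subgroupOf X)
  have hfin : (Set.range fun c : _root_.commutator (X ⧸ P.subgroupOf X) =>
    ((c : X ⧸ P.subgroupOf X).out : G)).Finite := Set.finite_range _
  refine ⟨hfin.toFinset, fun q hq => ?_⟩
  obtain ⟨c, hc, p, hp, rfl⟩ := mem_sup_of_le_normalizer (B := P) le_normalizer_of_normal hq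
  rw [← map_subtype_commutator] at hc
  obtain ⟨x, hx, rfl⟩ := hc
  have hx' : π x ∈ _root_.commutator (X ⧸ P.subgroupOf X) := by
    have h1 : π x ∈ (_root_.commutator X).map π := ⟨x, hx, rfl⟩
    rw [map_commutator_eq] at h1
    exact commutator_mono le_top le_top h1
  refine ⟨_, hfin.mem_toFinset.2 ⟨⟨_, hx'⟩, rfl⟩, ?_⟩
  have h2 : ((π x).out)⁻¹ * x ∈ P.subgroupOf X := by
    rw [← QuotientGroup.eq]
    exact QuotientGroup.out_eq' _
  simpa [mul_assoc] using mul_mem (mem_subgroupOf.1 h2) hp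

end Schur

/-! ### Finite rank and uniform rank in profinite groups. -/

theorem exists_range_eq_of_card_le {G : Type*} [Group G] {S : Finset G} {r : ℕ} (h : S.card ≤ r) :
    ∃ f : Fin r → G, (S : Set G) ⊆ Set.range f ∧ Set.range f ⊆ insert 1 (S : Set G) := by
  -- Padding with 1 gives every generating set the same length `r`, so that tuples live in one
  -- compact space.
  refine ⟨fun i => if hi : (i : ℕ) < S.card then S.equivFin.symm ⟨i, hi⟩ else 1, ?_, ?_⟩
  · intro x hx
    refine ⟨Fin.castLE h (S.equivFin ⟨x, hx⟩), ?_⟩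
    simp
  · rintro _ ⟨i, rfl⟩
    dsimp only
    split_ifs with hi
    · exact Or.inr (S.equivFin.symm ⟨i, hi⟩).2
    · exact Or.inl rfl

section Profinite

variable {G : Type*} [Group G] [TopologicalSpace G] [IsTopologicalGroup G]

/-- Such a set is a union of cosets of the open subgroup `U ^ ι`, and so is its complement. -/
theorem isClosed_of_forall_inv_mul_mem {ι : Type*} [Finite ι] (U : Subgroup G)
    (hU : IsOpen (U : Set G)) {s : Set (ι → G)}
    (hs : ∀ f ∈ s, ∀ g : ι → G, (∀ i, (f i)⁻¹ * g i ∈ U) → g ∈ s) : IsClosed s := by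
  rw [← isOpen_compl_iff, isOpen_iff_mem_nhds]
  intro f hf
  have hopen : IsOpen (⋂ i, {g : ι → G | (f i)⁻¹ * g i ∈ U}) :=
    isOpen_iInter_of_finite fun i =>
      hU.preimage (f := fun g : ι → G => (f i)⁻¹ * g i) (by fun_prop)
  refine Filter.mem_of_superset (hopen.mem_nhds ?_) fun g hg hgs => hf (hs g hgs f fun i => ?_)
  · simp [one_mem]
  · have := U.inv_mem (Set.mem_iInter.1 hg i)
    simpa using this

/-- Compactness: the `r`-tuples of `L` that generate `L` modulo `U` form a nonempty closed set `C
U`, shrinking with `U`. A tuple common to all `C U` generates a dense subgroup of `L`. -/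
theorem HasFiniteRank.hasUniformRank_top [CompactSpace G] [T2Space G] [TotallyDisconnectedSpace G]
    (h : HasFiniteRank G) : HasUniformRank (⊤ : Subgroup G) := by
  classical
  obtain ⟨r, hr⟩ := h
  refine ⟨r, fun L _ hLc => ?_⟩
  let C : OpenNormalSubgroup G → Set (Fin r → G) := fun U =>
    {f | (∀ i, f i ∈ L) ∧ L ≤ Subgroup.closure (Set.range f) ⊔ (U : Subgroup G)}
  have hUopen : ∀ U : OpenNormalSubgroup G, IsOpen ((U : Subgroup G) : Set G) := fun U => U.isOpen'
  have hCclosed : ∀ U, IsClosed (C U) := by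
    intro U
    have h1 : IsClosed {f : Fin r → G | ∀ i, f i ∈ L} := by
      simp only [Set.ofPred_forall]
      exact isClosed_iInter fun i => hLc.preimage (continuous_apply i)
    refine h1.inter (isClosed_of_forall_inv_mul_mem (U : Subgroup G) (hUopen U) ?_)
    intro f hf g hg
    change L ≤ Subgroup.closure (Set.range g) ⊔ (U : Subgroup G)
    replace hf : L ≤ Subgroup.closure (Set.range f) ⊔ (U : Subgroup G) := hf
    refine hf.trans (sup_le ((closure_le _).2 ?_) le_sup_right)
    rintro _ ⟨i, rfl⟩
    have h2 : g i * ((f i)⁻¹ * g i)⁻¹ = f i := by simp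
    rw [← h2]
    exact mul_mem_sup (subset_closure ⟨i, rfl⟩) (inv_mem (hg i))
  have hCne : ∀ U, (C U).Nonempty := by
    intro U
    have : Finite (G ⧸ (U : Subgroup G)) := Subgroup.quotient_finite_of_isOpen _ (hUopen U)
    -- A finite transversal of `L` modulo `U` spans a finitely generated subgroup, to which the rank
    -- bound applies even if `L` is not finitely generated.
    obtain ⟨T, hTL, hT⟩ := Set.exists_subset_bijOn (L : Set G)
      (QuotientGroup.mk : G → G ⧸ (U : Subgroup G))
    have hTfin : T.Finite := hT.finite_iff_finite.2 (Set.toFinite _)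
    obtain ⟨S, hScard, hS⟩ := hr (topologicalSpan T) ⟨hTfin.toFinset, by simp⟩
    obtain ⟨f, hf1, hf2⟩ := exists_range_eq_of_card_le hScard
    have hSL : (S : Set G) ⊆ L :=
      (subset_topologicalSpan _).trans (hS.le.trans (topologicalSpan_le hLc hTL))
    refine ⟨f, fun i => ?_, fun l hl => ?_⟩
    · rcases hf2 ⟨i, rfl⟩ with h1 | h1
      · rw [h1]; exact one_mem _
      · exact hSL h1
    · obtain ⟨t, ht, htl⟩ := hT.surjOn ⟨l, hl, rfl⟩
      have hcl : IsClosed ((Subgroup.closure (Set.range f) ⊔ (U : Subgroup G) : Subgroup G) : Set G) :=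
        Subgroup.isClosed_of_isOpen _ (Subgroup.isOpen_mono le_sup_right (hUopen U))
      have h1 : t ∈ Subgroup.closure (Set.range f) ⊔ (U : Subgroup G) := by
        refine topologicalSpan_le hcl ?_ (hS.ge (subset_topologicalSpan _ ht))
        exact hf1.trans (subset_closure.trans (SetLike.coe_subset_coe.2 le_sup_left))
      have h2 := mul_mem h1 ((le_sup_right : (U : Subgroup G) ≤ Subgroup.closure (Set.range f) ⊔ U)
        (QuotientGroup.eq.1 htl))
      simpa using h2
  have hdir : Directed (· ⊇ ·) C := by
    have hmono : ∀ U V : OpenNormalSubgroup G, U ≤ V → C U ⊆ C V := fun U V hUV f hf =>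
      ⟨hf.1, hf.2.trans (sup_le_sup_left (fun x hx => hUV hx) _)⟩
    exact fun U V => ⟨U ⊓ V, hmono _ _ inf_le_left, hmono _ _ inf_le_right⟩
  have : Nonempty (OpenNormalSubgroup G) :=
    ⟨(ProfiniteGrp.exist_openNormalSubgroup_sub_open_nhds_of_one
      isOpen_univ (Set.mem_univ (1 : G))).choose⟩
  obtain ⟨f, hf⟩ := IsCompact.nonempty_iInter_of_directed_nonempty_isCompact_isClosed C hdir hCne
    (fun U => (hCclosed U).isCompact) hCclosed
  rw [Set.mem_iInter] at hf
  have hfL : ∀ i, f i ∈ L :=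
    (hf (Classical.arbitrary _)).1
  refine ⟨Finset.univ.image f, Finset.card_image_le.trans (by simp), ?_⟩
  refine topologicalSpan_eq hLc (by simpa [Set.subset_def] using hfL) fun l hl => ?_
  simp only [Finset.coe_image, Finset.coe_univ, Set.image_univ]
  change l ∈ _root_.closure ((Subgroup.closure (Set.range f) : Subgroup G) : Set G)
  rw [mem_closure_iff]
  intro W hW hlW
  obtain ⟨U, hU⟩ := ProfiniteGrp.exist_openNormalSubgroup_sub_open_nhds_of_one
    (U := (fun x => l * x) ⁻¹' W) (hW.preimage (by fun_prop)) (by simpa using hlW)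
  obtain ⟨c, hc, u, hu, rfl⟩ := mem_sup_of_le_normalizer
    (B := (U : Subgroup G)) le_normalizer_of_normal ((hf U).2 hl)
  refine ⟨c, ?_, hc⟩
  have := hU (inv_mem hu)
  simpa using this

theorem topologicalSpan_image_subtype {K : Subgroup G} (hK : IsClosed (K : Set G)) (T : Set K) :
    topologicalSpan (Subtype.val '' T) = (topologicalSpan T).map K.subtype := by
  refine topologicalSpan_eq ?_ ?_ ?_
  · exact hK.isClosedEmbedding_subtypeVal.isClosedMap _ (isClosed_topologicalSpan T)
  · exact Set.image_mono (subset_topologicalSpan T)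
  · rw [map_le_iff_le_comap]
    refine topologicalSpan_le
      ((isClosed_topologicalSpan _).preimage continuous_subtype_val) fun x hx => ?_
    exact subset_topologicalSpan _ ⟨x, hx, rfl⟩

theorem HasFiniteRank.hasUniformRank [CompactSpace G] [T2Space G] [TotallyDisconnectedSpace G]
    {K : Subgroup G} (hK : IsClosed (K : Set G)) (h : HasFiniteRank K) : HasUniformRank K := by
  classical
  have : CompactSpace K := isCompact_iff_compactSpace.1 hK.isCompact
  obtain ⟨r, hr⟩ := h.hasUniformRank_top
  refine ⟨r, fun L hL hLc => ?_⟩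
  obtain ⟨S, hS, hSL⟩ := hr (L.subgroupOf K) le_top (hLc.preimage continuous_subtype_val)
  refine ⟨S.image Subtype.val, Finset.card_image_le.trans hS, ?_⟩
  rw [Finset.coe_image, topologicalSpan_image_subtype hK, hSL, subgroupOf_map_subtype,
    inf_eq_left.2 hL]

theorem HasUniformRank.hasFiniteRank {K : Subgroup G} (hK : IsClosed (K : Set G))
    (h : HasUniformRank K) : HasFiniteRank K := by
  classical
  obtain ⟨r, hr⟩ := h
  refine ⟨r, ?_⟩
  rintro _ ⟨T, rfl⟩
  have hclosed : IsClosed (((topologicalSpan (G := K) T).map K.subtype : Subgroup G) : Set G) :=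
    hK.isClosedEmbedding_subtypeVal.isClosedMap _ (isClosed_topologicalSpan (G := K) T)
  obtain ⟨S, hS, hSL⟩ := hr _ (map_subtype_le _) hclosed
  have hSK : ∀ x ∈ S, x ∈ K := fun x hx =>
    map_subtype_le _ (hSL.le (subset_topologicalSpan _ hx))
  refine ⟨S.subtype (· ∈ K), (Finset.card_subtype _ _).trans_le
    ((Finset.card_filter_le _ _).trans hS), ?_⟩
  apply map_injective K.subtype_injective
  rw [← topologicalSpan_image_subtype hK, ← hSL]
  congr 1
  ext x
  simpa using hSK x

end Profinite

/-! ### Commutator subgroups modulo a normal subgroup. -/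

section CommutatorLemmas

variable {G : Type*} [Group G]

/-- For fixed `U` and `R` the condition on `A` becomes containment in one subgroup, so it can be
tested on generators and passes to suprema. -/
theorem commutator_le_iff_le_comap_centralizer {A U R : Subgroup G} [R.Normal] :
    ⁅A, U⁆ ≤ R ↔
      A ≤ (centralizer (U.map (QuotientGroup.mk' R) : Set (G ⧸ R))).comap (QuotientGroup.mk' R) := by
  rw [← map_le_iff_le_comap, ← commutator_eq_bot_iff_le_centralizer, ← map_commutator,
    Subgroup.map_eq_bot_iff, QuotientGroup.ker_mk']

theorem commutator_closure_closure_le {A B : Set G} {R : Subgroup G} [R.Normal]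
    (h : ∀ a ∈ A, ∀ b ∈ B, ⁅a, b⁆ ∈ R) : ⁅closure A, closure B⁆ ≤ R := by
  rw [commutator_le_iff_le_comap_centralizer, closure_le, MonoidHom.map_closure,
    centralizer_closure]
  intro a ha
  rw [SetLike.mem_coe, mem_comap, mem_centralizer_iff]
  rintro _ ⟨b, hb, rfl⟩
  rw [eq_comm, ← commutatorElement_eq_one_iff_mul_comm, ← map_commutatorElement,
    QuotientGroup.mk'_apply, QuotientGroup.eq_one_iff]
  exact h a ha b hb

theorem commutator_iSup_le_left {ι : Sort*} {A : ι → Subgroup G} {U R : Subgroup G} [R.Normal]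
    (h : ∀ i, ⁅A i, U⁆ ≤ R) : ⁅⨆ i, A i, U⁆ ≤ R :=
  commutator_le_iff_le_comap_centralizer.2
    (iSup_le fun i => commutator_le_iff_le_comap_centralizer.1 (h i))

/-- The three subgroups lemma, applied in `G ⧸ R`. -/
theorem commutator_commutator_le_of_rotate {H₁ H₂ H₃ R : Subgroup G} [R.Normal]
    (h1 : ⁅⁅H₂, H₃⁆, H₁⁆ ≤ R) (h2 : ⁅⁅H₃, H₁⁆, H₂⁆ ≤ R) : ⁅⁅H₁, H₂⁆, H₃⁆ ≤ R := by
  have key : ∀ A : Subgroup G, A ≤ R ↔ A.map (QuotientGroup.mk' R) = ⊥ := fun A => by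
    rw [Subgroup.map_eq_bot_iff, QuotientGroup.ker_mk']
  rw [key, map_commutator, map_commutator] at *
  exact commutator_commutator_eq_bot_of_rotate h1 h2

theorem normal_closure_of_conj_mem {A : Set G} (h : ∀ a ∈ A, ∀ g : G, g * a * g⁻¹ ∈ A) :
    (closure A).Normal := by
  refine normalizer_eq_top_iff.1 (top_le_iff.1 ?_)
  rw [le_normalizer_closure_iff]
  exact fun g _ a ha => subset_closure (h a ha g)

end CommutatorLemmas

/-! ### Values and verbal subgroups of outer commutator words. -/

section OuterCommutatorWords

variable {α : Type*} {G : Type*} [Group G]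

theorem lift_conj (k : G) (g : α → G) (u : FreeGroup α) :
    k * FreeGroup.lift g u * k⁻¹ = FreeGroup.lift (fun j => k * g j * k⁻¹) u := by
  have : (MulAut.conj k).toMonoidHom.comp (FreeGroup.lift g) =
      FreeGroup.lift (fun j => k * g j * k⁻¹) := by
    ext j
    simp
  simpa using DFunLike.congr_fun this u

theorem IsOuterCommutatorOn.finite {u : FreeGroup α} {S : Set α} (h : IsOuterCommutatorOn u S) :
    S.Finite := by
  induction h with
  | var x => exact Set.finite_singleton x
  | comm _ _ _ hS hT => exact hS.union hT

theorem IsOuterCommutatorOn.lift_congr {u : FreeGroup α} {S : Set α}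
    (h : IsOuterCommutatorOn u S) {g g' : α → G} (hg : Set.EqOn g g' S) :
    FreeGroup.lift g u = FreeGroup.lift g' u := by
  induction h with
  | var x => simpa using hg rfl
  | comm _ _ _ hS hT =>
    rw [map_commutatorElement, map_commutatorElement, hS (hg.mono Set.subset_union_left),
      hT (hg.mono Set.subset_union_right)]

theorem IsOuterCommutatorOn.lift_mem {u : FreeGroup α} {S : Set α}
    (h : IsOuterCommutatorOn u S) {N : Subgroup G} [hN : N.Normal] {g : α → G} {i : α}
    (hi : i ∈ S) (hg : g i ∈ N) : FreeGroup.lift g u ∈ N := by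
  induction h with
  | var x =>
    rw [Set.mem_singleton_iff] at hi
    subst hi
    simpa using hg
  | @comm u v S T _ _ _ hS hT =>
    rw [map_commutatorElement]
    rcases hi with hi | hi
    · exact commutator_le_left N ⊤ (commutator_mem_commutator (hS hi) (mem_top _))
    · exact commutator_le_right ⊤ N (commutator_mem_commutator (mem_top _) (hT hi))

theorem conj_mul_inv_mem {N : Subgroup G} [hN : N.Normal] {k z x : G} (hk : k ∈ N)
    (h : z * x⁻¹ ∈ N) : k * z * k⁻¹ * x⁻¹ ∈ N := by
  have h1 : k * (z * k⁻¹ * z⁻¹) * (z * x⁻¹) ∈ N :=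
    mul_mem (mul_mem hk (hN.conj_mem _ (inv_mem hk) z)) h
  simpa [mul_assoc] using h1

open Classical in
/-- A value of an outer commutator word splits when one of its arguments is multiplied by an
element of a normal subgroup `N`; the other factor is a value at a tuple congruent modulo `N`. -/
theorem IsOuterCommutatorOn.exists_lift_update_mul {u : FreeGroup α} {S : Set α}
    (h : IsOuterCommutatorOn u S) {N : Subgroup G} [hN : N.Normal] {i : α} (hi : i ∈ S)
    (x : α → G) {y : G} (hy : y ∈ N) :
    ∃ x' : α → G, (∀ j, x' j * (x j)⁻¹ ∈ N) ∧
      FreeGroup.lift (Function.update x i (y * x i)) u =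
        FreeGroup.lift (Function.update x i y) u * FreeGroup.lift x' u := by
  induction h with
  | var a =>
    rw [Set.mem_singleton_iff] at hi
    subst hi
    exact ⟨x, by simp [one_mem], by simp⟩
  | @comm u v S T hu hv hST hS hT =>
    have hoff : ∀ {t : FreeGroup α} {R : Set α}, IsOuterCommutatorOn t R → i ∉ R → ∀ a : G,
        FreeGroup.lift (Function.update x i a) t = FreeGroup.lift x t := fun ht hiR a =>
      ht.lift_congr fun j hj => Function.update_of_ne (ne_of_mem_of_not_mem hj hiR) _ _
    have hyi : Function.update x i y i ∈ N := by simpa using hy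
    rcases hi with hi | hi
    · obtain ⟨x', hx', heq⟩ := hS hi
      have hiT : i ∉ T := fun h => Set.disjoint_left.1 hST hi h
      set B := FreeGroup.lift (Function.update x i y) u with hB
      have hBN : B ∈ N := hu.lift_mem hi hyi
      set c := FreeGroup.lift x v with hc
      have hk : ⁅B, c⁆⁻¹ * B ∈ N := mul_mem (inv_mem
        (commutator_le_left N ⊤ (commutator_mem_commutator hBN (mem_top _)))) hBN
      have h1 : FreeGroup.lift (S.piecewise x' x) u = FreeGroup.lift x' u :=
        hu.lift_congr fun j hj => Set.piecewise_eq_of_mem _ _ _ hj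
      have h2 : FreeGroup.lift (S.piecewise x' x) v = c :=
        hv.lift_congr fun j hj => Set.piecewise_eq_of_notMem _ _ _
          (Set.disjoint_right.1 hST hj)
      -- With `C` the value of `u` at `x'`, `⁅B * C, c⁆ = B⁅C, c⁆B⁻¹⁅B, c⁆`. Moving `⁅B, c⁆` to the
      -- front conjugates `⁅C, c⁆` by `⁅B, c⁆⁻¹ * B`, an element of `N`, so the congruence modulo
      -- `N` is kept.
      refine ⟨fun j => (⁅B, c⁆⁻¹ * B) * S.piecewise x' x j * (⁅B, c⁆⁻¹ * B)⁻¹, fun j => ?_, ?_⟩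
      · refine conj_mul_inv_mem hk ?_
        by_cases hj : j ∈ S
        · rw [Set.piecewise_eq_of_mem _ _ _ hj]; exact hx' j
        · rw [Set.piecewise_eq_of_notMem _ _ _ hj]; simp [one_mem]
      · rw [← lift_conj, map_commutatorElement, map_commutatorElement, map_commutatorElement,
          hoff hv hiT, hoff hv hiT, heq, h1, h2, commutatorElement_mul_left_eq_conj_mul,
          ← hB, ← hc]
        group
    · obtain ⟨x', hx', heq⟩ := hT hi
      have hiS : i ∉ S := fun h => Set.disjoint_left.1 hST h hi
      set B := FreeGroup.lift (Function.update x i y) v with hB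
      have hBN : B ∈ N := hv.lift_mem hi hyi
      have h1 : FreeGroup.lift (T.piecewise x' x) v = FreeGroup.lift x' v :=
        hv.lift_congr fun j hj => Set.piecewise_eq_of_mem _ _ _ hj
      have h2 : FreeGroup.lift (T.piecewise x' x) u = FreeGroup.lift x u :=
        hu.lift_congr fun j hj => Set.piecewise_eq_of_notMem _ _ _
          (Set.disjoint_left.1 hST hj)
      refine ⟨fun j => B * T.piecewise x' x j * B⁻¹, fun j => ?_, ?_⟩
      · refine conj_mul_inv_mem hBN ?_
        by_cases hj : j ∈ T
        · rw [Set.piecewise_eq_of_mem _ _ _ hj]; exact hx' j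
        · rw [Set.piecewise_eq_of_notMem _ _ _ hj]; simp [one_mem]
      · rw [← lift_conj, map_commutatorElement, map_commutatorElement, map_commutatorElement,
          hoff hu hiS, hoff hu hiS, heq, h1, h2, commutatorElement_mul_right_eq_mul_conj,
          ← hB]
        group

open Classical in
/-- If all values of an outer commutator word on some cosets of a normal subgroup `N` lie in the
subgroup `H`, then so do all its values on `N`. -/
theorem IsOuterCommutatorOn.lift_mem_of_forall_coset {u : FreeGroup α} {S : Set α}
    (h : IsOuterCommutatorOn u S) {N H : Subgroup G} [hN : N.Normal] {b : α → G}
    (hb : ∀ z : α → G, (∀ j, z j * (b j)⁻¹ ∈ N) → FreeGroup.lift z u ∈ H)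
    {z : α → G} (hz : ∀ j, z j ∈ N) : FreeGroup.lift z u ∈ H := by
  -- Coordinates in `s` already lie in `N`, the others still in their cosets; the empty set is the
  -- hypothesis.
  have key : ∀ s : Finset α, (s : Set α) ⊆ S → ∀ z : α → G, (∀ j ∈ s, z j ∈ N) →
      (∀ j ∉ s, z j * (b j)⁻¹ ∈ N) → FreeGroup.lift z u ∈ H := by
    intro s
    induction s using Finset.induction_on with
    | empty => exact fun _ z _ hz => hb z fun j => hz j (Finset.notMem_empty j)
    | insert a s ha ih =>
      intro hsS z hz1 hz2
      have hsS' : (s : Set α) ⊆ S := fun j hj => hsS (Finset.mem_insert_of_mem hj)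
      -- The value with `z a * b a` at `a` is the value at `z` times the value at `x'`. The tuples
      -- of the first and last values have coordinate `a` in the coset of `b a`, so induction puts
      -- both in `H`, hence also the value at `z`.
      obtain ⟨x', hx', heq⟩ := h.exists_lift_update_mul (hsS (Finset.mem_insert_self a s))
        (Function.update z a (b a)) (hz1 a (Finset.mem_insert_self a s))
      simp only [Function.update_idem, Function.update_self, Function.update_eq_self] at heq
      have hne : ∀ j ∈ s, j ≠ a := fun j hj hja => ha (hja ▸ hj)
      have h1 : FreeGroup.lift (Function.update z a (z a * b a)) u ∈ H := by
        refine ih hsS' _ (fun j hj => ?_) (fun j hj => ?_)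
        · rw [Function.update_of_ne (hne j hj)]
          exact hz1 j (Finset.mem_insert_of_mem hj)
        · rcases eq_or_ne j a with rfl | hja
          · simpa using hz1 j (Finset.mem_insert_self j s)
          · rw [Function.update_of_ne hja]
            exact hz2 j (by simp [hja, hj])
      have h2 : FreeGroup.lift x' u ∈ H := by
        refine ih hsS' _ (fun j hj => ?_) (fun j hj => ?_)
        · have h3 := hx' j
          rw [Function.update_of_ne (hne j hj)] at h3
          simpa using mul_mem h3 (hz1 j (Finset.mem_insert_of_mem hj))
        · have h3 := hx' j
          rcases eq_or_ne j a with rfl | hja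
          · simpa using h3
          · rw [Function.update_of_ne hja] at h3
            simpa using mul_mem h3 (hz2 j (by simp [hja, hj]))
      rw [heq] at h1
      simpa using mul_mem h1 (inv_mem h2)
  have h1 : FreeGroup.lift z u = FreeGroup.lift (S.piecewise z b) u :=
    h.lift_congr fun j hj => (Set.piecewise_eq_of_mem _ _ _ hj).symm
  rw [h1]
  refine key h.finite.toFinset (by simp) _ (fun j hj => ?_) (fun j hj => ?_)
  · rw [Set.piecewise_eq_of_mem _ _ _ (by simpa using hj)]; exact hz j
  · rw [Set.piecewise_eq_of_notMem _ _ _ (by simpa using hj)]; simp [one_mem]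

/-- The values of the word `w` whose variables are substituted from given subgroups. -/
def wordValuesIn (w : FreeGroup α) (M : α → Subgroup G) : Set G :=
  {x | ∃ g : α → G, (∀ j, g j ∈ M j) ∧ FreeGroup.lift g w = x}

/-- The subgroup generated by the values of `w` with variables substituted from given subgroups. -/
def verbalIn (w : FreeGroup α) (M : α → Subgroup G) : Subgroup G :=
  closure (wordValuesIn w M)

theorem verbalIn_normal (w : FreeGroup α) {M : α → Subgroup G} (hM : ∀ j, (M j).Normal) :
    (verbalIn w M).Normal := by
  refine normal_closure_of_conj_mem ?_
  rintro _ ⟨g, hg, rfl⟩ k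
  exact ⟨_, fun j => (hM j).conj_mem _ (hg j) k, (lift_conj k g w).symm⟩

open Classical in
theorem IsOuterCommutatorOn.verbalIn_mono {u : FreeGroup α} {S : Set α}
    (h : IsOuterCommutatorOn u S) {M M' : α → Subgroup G} (hM : ∀ j ∈ S, M j ≤ M' j) :
    verbalIn u M ≤ verbalIn u M' := by
  refine closure_mono ?_
  rintro _ ⟨g, hg, rfl⟩
  refine ⟨S.piecewise g 1, fun j => ?_,
    h.lift_congr fun j hj => Set.piecewise_eq_of_mem _ _ _ hj⟩
  by_cases hj : j ∈ S
  · rw [Set.piecewise_eq_of_mem _ _ _ hj]; exact hM j hj (hg j)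
  · rw [Set.piecewise_eq_of_notMem _ _ _ hj]; exact one_mem _

theorem IsOuterCommutatorOn.verbalIn_le {u : FreeGroup α} {S : Set α}
    (h : IsOuterCommutatorOn u S) {M : α → Subgroup G} {i : α} (hi : i ∈ S)
    (hM : (M i).Normal) : verbalIn u M ≤ M i := by
  refine (closure_le _).2 ?_
  rintro _ ⟨g, hg, rfl⟩
  exact h.lift_mem hi (hg i)

open Classical in
-- Disjointness of the variables lets the values of `u` and `v` be chosen independently; normality
-- reduces the commutator of the subgroups to commutators of generators.
theorem verbalIn_commutator {u v : FreeGroup α} {S T : Set α} (hu : IsOuterCommutatorOn u S)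
    (hv : IsOuterCommutatorOn v T) (hST : Disjoint S T) {M : α → Subgroup G}
    (hM : ∀ j, (M j).Normal) : verbalIn ⁅u, v⁆ M = ⁅verbalIn u M, verbalIn v M⁆ := by
  apply le_antisymm
  · refine (closure_le _).2 ?_
    rintro _ ⟨g, hg, rfl⟩
    rw [map_commutatorElement]
    exact commutator_mem_commutator (subset_closure ⟨g, hg, rfl⟩) (subset_closure ⟨g, hg, rfl⟩)
  · have := verbalIn_normal ⁅u, v⁆ hM
    refine commutator_closure_closure_le ?_
    rintro _ ⟨g, hg, rfl⟩ _ ⟨g', hg', rfl⟩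
    refine subset_closure ⟨S.piecewise g g', fun j => ?_, ?_⟩
    · by_cases hj : j ∈ S
      · rw [Set.piecewise_eq_of_mem _ _ _ hj]; exact hg j
      · rw [Set.piecewise_eq_of_notMem _ _ _ hj]; exact hg' j
    · rw [map_commutatorElement,
        hu.lift_congr (g' := g) fun j hj => Set.piecewise_eq_of_mem _ _ _ hj,
        hv.lift_congr (g' := g') fun j hj => Set.piecewise_eq_of_notMem _ _ _
          (Set.disjoint_right.1 hST hj)]

open Classical in
/-- Commutation with a normal subgroup acts like a derivation on `verbalIn`. -/
theorem IsOuterCommutatorOn.commutator_verbalIn_le {u : FreeGroup α} {S : Set α}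
    (h : IsOuterCommutatorOn u S) {M : α → Subgroup G} (hM : ∀ j, (M j).Normal)
    {K : Subgroup G} [K.Normal] :
    ⁅verbalIn u M, K⁆ ≤ ⨆ i ∈ S, verbalIn u (Function.update M i ⁅M i, K⁆) := by
  have hMi : ∀ i j, (Function.update M i ⁅M i, K⁆ j).Normal := by
    intro i j
    have := hM i
    rcases eq_or_ne j i with rfl | hji
    · rw [Function.update_self]; infer_instance
    · rw [Function.update_of_ne hji]; exact hM j
  induction h with
  | var x =>
    simp only [Set.mem_singleton_iff, iSup_iSup_eq_left]
    rw [commutator_le]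
    intro a ha k hk
    refine subset_closure ⟨Function.update (1 : α → G) x ⁅a, k⁆, fun j => ?_, by simp⟩
    rcases eq_or_ne j x with rfl | hjx
    · simp only [Function.update_self]
      exact commutator_mem_commutator
        ((IsOuterCommutatorOn.var j).verbalIn_le rfl (hM j) ha) hk
    · rw [Function.update_of_ne hjx, Function.update_of_ne hjx]; exact (M j).one_mem
  | @comm u v S T hu hv hST hS hT =>
    set R := ⨆ i ∈ S ∪ T, verbalIn ⁅u, v⁆ (Function.update M i ⁅M i, K⁆) with hR
    have := fun i => verbalIn_normal ⁅u, v⁆ (hMi i)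
    have hoff : ∀ {t : FreeGroup α} {Q : Set α} {i : α}, IsOuterCommutatorOn t Q → i ∉ Q →
        verbalIn t M ≤ verbalIn t (Function.update M i ⁅M i, K⁆) := fun ht hi =>
      ht.verbalIn_mono fun j hj => by rw [Function.update_of_ne (ne_of_mem_of_not_mem hj hi)]
    rw [verbalIn_commutator hu hv hST hM]
    -- By the three subgroups lemma it suffices to commute `K` with one factor at a time, where
    -- induction applies; the other factor does not involve the modified variable.
    refine commutator_commutator_le_of_rotate ?_ ?_
    · refine (commutator_mono hT le_rfl).trans ?_
      refine commutator_iSup_le_left fun i => commutator_iSup_le_left fun hi => ?_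
      refine le_trans ?_ (le_iSup₂_of_le i (Or.inr hi) le_rfl)
      rw [commutator_comm, verbalIn_commutator hu hv hST (hMi i)]
      exact commutator_mono (hoff hu (Set.disjoint_right.1 hST hi)) le_rfl
    · rw [commutator_comm K]
      refine (commutator_mono hS le_rfl).trans ?_
      refine commutator_iSup_le_left fun i => commutator_iSup_le_left fun hi => ?_
      refine le_trans ?_ (le_iSup₂_of_le i (Or.inl hi) le_rfl)
      rw [verbalIn_commutator hu hv hST (hMi i)]
      exact commutator_mono le_rfl (hoff hv (Set.disjoint_left.1 hST hi))

/-- The series `⊤, N, N', N'', …`. -/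
def derivedSeriesFrom (N : Subgroup G) : ℕ → Subgroup G
  | 0 => ⊤
  | 1 => N
  | k + 2 => ⁅derivedSeriesFrom N (k + 1), derivedSeriesFrom N (k + 1)⁆

theorem derivedSeriesFrom_normal (N : Subgroup G) [N.Normal] :
    ∀ k, (derivedSeriesFrom N k).Normal
  | 0 => inferInstanceAs (⊤ : Subgroup G).Normal
  | 1 => inferInstanceAs N.Normal
  | k + 2 => by
    have := derivedSeriesFrom_normal N (k + 1)
    rw [derivedSeriesFrom]
    infer_instance

theorem derivedSeriesFrom_antitone (N : Subgroup G) : Antitone (derivedSeriesFrom N) := by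
  refine antitone_nat_of_succ_le fun k => ?_
  match k with
  | 0 => exact le_top
  | k + 1 => exact commutator_le_self _

/-- At index 0 the normality of `K ≤ N` suffices; beyond it the next term is a derived subgroup, so
`K` must lie in the current one. -/
theorem commutator_derivedSeriesFrom_le {N K : Subgroup G} [K.Normal] (hK : K ≤ N) (k : ℕ)
    (hk : k ≠ 0 → K ≤ derivedSeriesFrom N k) :
    ⁅derivedSeriesFrom N k, K⁆ ≤ derivedSeriesFrom N (k + 1) := by
  match k with
  | 0 => exact (commutator_le_right _ _).trans hK
  | k + 1 => exact commutator_mono le_rfl (hk k.succ_ne_zero)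

theorem IsOuterCommutatorOn.exists_derivedSeriesFrom_le {u : FreeGroup α} {S : Set α}
    (h : IsOuterCommutatorOn u S) (N : Subgroup G) [hN : N.Normal] :
    ∃ k, derivedSeriesFrom N (k + 1) ≤ verbalIn u fun _ => N := by
  induction h with
  | var x => exact ⟨0, fun y hy => subset_closure ⟨fun _ => y, fun _ => hy, by simp⟩⟩
  | comm hu hv hST hS hT =>
    obtain ⟨k, hk⟩ := hS
    obtain ⟨l, hl⟩ := hT
    -- One more derived step than the deeper factor needs, as the word is a commutator of the two.
    refine ⟨max k l + 1, ?_⟩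
    rw [verbalIn_commutator hu hv hST fun _ => hN]
    exact commutator_mono
      ((derivedSeriesFrom_antitone N (by simp)).trans hk)
      ((derivedSeriesFrom_antitone N (by simp)).trans hl)

end OuterCommutatorWords

/-! ### Baire category and the downward induction. -/

section Main

variable {α : Type*} {G : Type*} [Group G] [TopologicalSpace G] [IsTopologicalGroup G]

theorem IsOuterCommutatorOn.continuous_lift {u : FreeGroup α} {S : Set α}
    (h : IsOuterCommutatorOn u S) : Continuous fun g : α → G => FreeGroup.lift g u := by
  induction h with
  | var x => simpa using continuous_apply x
  | comm _ _ _ hS hT =>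
    refine (((hS.mul hT).mul hS.inv).mul hT.inv).congr fun g => ?_
    simp [commutatorElement_def]

/-- If the values of an outer commutator word are covered by finitely many closed subgroups, then
one of them contains all values on some cosets of an open normal subgroup. -/
theorem IsOuterCommutatorOn.exists_openNormalSubgroup_coset [CompactSpace G] [T2Space G]
    [TotallyDisconnectedSpace G] {w : FreeGroup α} {S : Set α} (hw : IsOuterCommutatorOn w S)
    {ι : Type*} [Finite ι] {H : ι → Subgroup G} (hclosed : ∀ i, IsClosed (H i : Set G))
    (hcover : wordValues w G ⊆ ⋃ i, (H i : Set G)) :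
    ∃ (N : OpenNormalSubgroup G) (i : ι) (b : α → G), ∀ z : α → G,
      (∀ j, z j * (b j)⁻¹ ∈ (N : Subgroup G)) → FreeGroup.lift z w ∈ H i := by
  -- Baire category in the compact Hausdorff space `α → G`.
  obtain ⟨i, b, hb⟩ := nonempty_interior_of_iUnion_of_closed
    (f := fun i => (fun g : α → G => FreeGroup.lift g w) ⁻¹' (H i : Set G))
    (fun i => (hclosed i).preimage hw.continuous_lift)
    (by
      rw [← Set.preimage_iUnion, Set.eq_univ_iff_forall]
      exact fun g => hcover ⟨g, rfl⟩)
  obtain ⟨I, u, hu, hsub⟩ := isOpen_pi_iff.1 isOpen_interior b hb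
  have hW : IsOpen (⋂ j ∈ I, (fun x => x * b j) ⁻¹' u j) :=
    isOpen_biInter_finset fun j hj => (hu j hj).1.preimage (by fun_prop)
  obtain ⟨N, hN⟩ := ProfiniteGrp.exist_openNormalSubgroup_sub_open_nhds_of_one hW
    (by simpa using fun j hj => (hu j hj).2)
  refine ⟨N, i, b, fun z hz => ?_⟩
  suffices z ∈ (I : Set α).pi u from
    (interior_subset (hsub this) : z ∈ (fun g : α → G => FreeGroup.lift g w) ⁻¹' (H i : Set G))
  intro j hj
  have := Set.mem_iInter₂.1 (hN (hz j)) j hj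
  simpa using this

/-- As `N` is open, the closure of `V` meets `N` inside the closure of `V ⊓ N`; then continuity of
the commutator applies. -/
theorem commutator_topologicalClosure_inf_le {V N P : Subgroup G} (hN : IsOpen (N : Set G))
    (hP : IsClosed (P : Set G)) (h : ⁅V, V ⊓ N⁆ ≤ P) :
    ⁅V.topologicalClosure, V.topologicalClosure ⊓ N⁆ ≤ P := by
  rw [commutator_le]
  rintro x hx y ⟨hy, hyN⟩
  have hy' : y ∈ _root_.closure ((V ⊓ N : Subgroup G) : Set G) :=
    hN.closure_inter ⟨hy, hyN⟩
  have hcont : Continuous fun p : G × G => ⁅p.1, p.2⁆ := by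
    simp only [commutatorElement_def]
    fun_prop
  have := map_mem_closure₂ (f := fun a b : G => ⁅a, b⁆) (u := (P : Set G)) hcont hx hy'
    fun a ha b hb => h (commutator_mem_commutator ha hb)
  rwa [hP.closure_eq] at this

/-- A closed normal subgroup which modulo `P` is central-by-finite and topologically generated by
elements of finitely many subgroups of finite rank has finite rank if `P` does. -/
theorem HasUniformRank.of_commutator_inf_le [CompactSpace G] [T2Space G] {ι : Type*} [Finite ι]
    {P X N : Subgroup G} [P.Normal] (hN : IsOpen (N : Set G)) (hP : IsClosed (P : Set G))
    (hPX : P ≤ X) (hXP : ⁅X, X ⊓ N⁆ ≤ P) (hrP : HasUniformRank P) (H : ι → Subgroup G)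
    (hH : ∀ i, IsClosed (H i : Set G)) (hrH : ∀ i, HasUniformRank (H i))
    (hX : IsClosed (X : Set G)) {Y : Set G} (hY : Y ⊆ ⋃ i, (H i : Set G))
    (hYX : topologicalSpan Y = X) : HasUniformRank X := by
  have : Finite (G ⧸ N) := Subgroup.quotient_finite_of_isOpen _ hN
  have : N.FiniteIndex := Subgroup.finiteIndex_of_finite_quotient
  -- By Schur, `⁅X, X⁆ ⊔ P` is covered by finitely many cosets of `P`, hence is closed of finite
  -- rank, and `X` is abelian modulo it.
  obtain ⟨F, hF⟩ := exists_finset_cosets_commutator hXP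
  exact HasUniformRank.of_commutator_le (isClosed_of_finite_cosets hP le_sup_right F hF)
    (sup_le (commutator_le_self X) hPX) le_sup_left (hrP.of_finite_cosets hP F hF) H hH hrH hX hY
    hYX

open Classical in
theorem IsOuterCommutatorOn.hasUniformRank_verbalIn [CompactSpace G] [T2Space G]
    {w : FreeGroup α} {S : Set α} (hw : IsOuterCommutatorOn w S)
    {ι : Type*} [Finite ι] {H : ι → Subgroup G} (hclosed : ∀ i, IsClosed (H i : Set G))
    (hcover : wordValues w G ⊆ ⋃ i, (H i : Set G)) (hrank : ∀ i, HasUniformRank (H i))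
    {N : Subgroup G} [N.Normal] (hN : IsOpen (N : Set G))
    (hrN : HasUniformRank (verbalIn w fun _ => N).topologicalClosure) (d : α → ℕ) :
    HasUniformRank (verbalIn w fun j => derivedSeriesFrom N (d j)).topologicalClosure := by
  obtain ⟨h, hh⟩ := hw.exists_derivedSeriesFrom_le N
  have hD : ∀ k, (derivedSeriesFrom N k).Normal := derivedSeriesFrom_normal N
  have hV : ∀ d : α → ℕ, (verbalIn w fun j => derivedSeriesFrom N (d j)).Normal := fun d =>
    verbalIn_normal w fun j => hD (d j)
  -- The sum measures the total distance of the variables in `S` from depth `h + 1`, where the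
  -- series has entered `w(N)`.
  induction hn : ∑ j ∈ hw.finite.toFinset, (h + 1 - d j) using Nat.strong_induction_on
    generalizing d with
  | _ n ih =>
  by_cases hd : ∃ j ∈ S, h + 1 ≤ d j
  · obtain ⟨j, hj, hdj⟩ := hd
    refine hrN.mono (Subgroup.topologicalClosure_mono ?_)
    exact (hw.verbalIn_le hj (hD (d j))).trans ((derivedSeriesFrom_antitone N hdj).trans hh)
  push Not at hd
  set V := verbalIn w fun j => derivedSeriesFrom N (d j) with hVdef
  let A : α → Subgroup G := fun i =>
    (verbalIn w fun j => derivedSeriesFrom N (Function.update d i (d i + 1) j)).topologicalClosure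
  have hA : ∀ i ∈ hw.finite.toFinset, HasUniformRank (A i) := by
    intro i hi
    refine ih _ ?_ _ rfl
    rw [← hn]
    refine Finset.sum_lt_sum (fun j _ => ?_) ⟨i, hi, ?_⟩
    · rcases eq_or_ne j i with rfl | hji
      · rw [Function.update_self]; omega
      · rw [Function.update_of_ne hji]
    · have := hd i (by simpa using hi)
      rw [Function.update_self]; omega
  obtain ⟨hPn, hPc, hPr⟩ := HasUniformRank.iSup_of_normal hw.finite.toFinset A
    (fun i _ => by
      have := hV (Function.update d i (d i + 1))
      exact Subgroup.is_normal_topologicalClosure _)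
    (fun i _ => Subgroup.isClosed_topologicalClosure _) hA
  have hAP : ∀ i ∈ S, A i ≤ ⨆ i ∈ hw.finite.toFinset, A i := fun i hi =>
    le_iSup₂_of_le i (by simpa using hi) le_rfl
  have hKn : (V ⊓ N).Normal := by
    have := hV d
    infer_instance
  refine HasUniformRank.of_commutator_inf_le (Y := wordValuesIn w _) hN hPc ?_ ?_ hPr H hclosed
    hrank (Subgroup.isClosed_topologicalClosure _) ?_ rfl
  · refine iSup₂_le fun i _ => Subgroup.topologicalClosure_mono (hw.verbalIn_mono fun j _ => ?_)
    refine derivedSeriesFrom_antitone N ?_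
    rcases eq_or_ne j i with rfl | hji
    · rw [Function.update_self]; omega
    · rw [Function.update_of_ne hji]
  · refine commutator_topologicalClosure_inf_le hN hPc ?_
    -- The derivation rule with `K = V ⊓ N`: as `V` lies in every term used for a variable in `S`,
    -- commuting that term with `K` lands one step deeper.
    refine (hw.commutator_verbalIn_le fun j => hD (d j)).trans (iSup₂_le fun i hi => ?_)
    refine le_trans (le_trans (hw.verbalIn_mono fun j _ => ?_)
      (Subgroup.le_topologicalClosure _)) (hAP i hi)
    rcases eq_or_ne j i with rfl | hji
    · rw [Function.update_self, Function.update_self]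
      exact commutator_derivedSeriesFrom_le inf_le_right _
        fun _ => inf_le_left.trans (hw.verbalIn_le hi (hD (d j)))
    · rw [Function.update_of_ne hji, Function.update_of_ne hji]
  · rintro _ ⟨g, -, rfl⟩
    exact hcover ⟨g, rfl⟩

end Main

theorem theorem1p3 {α : Type*} (w : FreeGroup α) (hw : IsOuterCommutatorWord w)
    {G : Type*} [Group G] [TopologicalSpace G] [IsTopologicalGroup G]
    [CompactSpace G] [T2Space G] [TotallyDisconnectedSpace G]
    {s : ℕ} (H : Fin s → Subgroup G)
    (hclosed : ∀ i, IsClosed (H i : Set G))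
    (hcover : wordValues w G ⊆ ⋃ i, (H i : Set G))
    (hrank : ∀ i, HasFiniteRank (H i)) :
    HasFiniteRank (verbalSubgroup w G) := by
  obtain ⟨S, hS⟩ := hw
  have hrank' : ∀ i, HasUniformRank (H i) := fun i => (hrank i).hasUniformRank (hclosed i)
  obtain ⟨N, i, b, hb⟩ := hS.exists_openNormalSubgroup_coset hclosed hcover
  have hrN : HasUniformRank (verbalIn w fun _ => (N : Subgroup G)).topologicalClosure := by
    refine (hrank' i).mono (topologicalSpan_le (hclosed i) ?_)
    rintro _ ⟨z, hz, rfl⟩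
    exact hS.lift_mem_of_forall_coset hb hz
  -- Depth 0 in every variable is the term `⊤`, so this is the full verbal subgroup.
  have hall := hS.hasUniformRank_verbalIn hclosed hcover hrank' N.isOpen' hrN fun _ => 0
  refine HasUniformRank.hasFiniteRank (isClosed_topologicalSpan _) ?_
  refine hall.mono (topologicalSpan_le (isClosed_topologicalSpan _) ?_)
  rintro _ ⟨g, rfl⟩
  exact subset_topologicalSpan _ ⟨g, fun _ => mem_top _, rfl⟩
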